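/- \textbf{Setting.} Let $\mathcal P^n=\{I,X,Y,Z\}^{\otimes n}$ be the set of the $4^n$ $n$-qubit Pauli matrices. An $n$-qubit \emph{Clifford unitary} is a unitary $U$ on $(\mathbb C^2)^{\otimes n}$ such that $UPU^\dagger\in\pm\mathcal P^n$ for all $P\in\mathcal P^n$. Two unitaries $U,\tilde U$ are \emph{equal as channels} if $U\rho U^\dagger=\tilde U\rho\tilde U^\dagger$ for all density matrices $\rho$. \textbf{The test.} Let $U$ (known) and $\tilde U$ (a black box) be $n$-qubit Clifford unitaries. One run of the test is as follows. Draw $P\in\mathcal P^n$ uniformly at random and compute $Q=U^\dagger PU=s\,Q_1\otimes\cdots\otimes Q_n$, with $s\in\{+1,-1\}$ and $Q_j\in\{I,X,Y,Z\}$. Prepare the product state $|\psi_{in}\rangle$ whose $j$-th qubit is, if $Q_j\in\{X,Y,Z\}$, the $\sigma_j$-eigenstate of $Q_j$ for an independent uniformly random sign $\sigma_j\in\{+1,-1\}$, and, if $Q_j=I$, the state $\frac1{\sqrt2}(|0\rangle+e^{i\pi/4}|1\rangle)$. Put $\lambda=s\prod_{j:Q_j\neq I}\sigma_j$. Apply $\tilde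 U$ once to $|\psi_{in}\rangle$ and measure the $\pm1$-valued observable $P$ on the result. \textbf{Theorem.} Every circuit of Pauli, Hadamard, phase ($S$) and CNOT gates is a Clifford unitary. Moreover, there are absolute constants $c,C>0$ such that for every $n$ and all $n$-qubit Clifford unitaries $U,\tilde U$ the following hold. \begin{enumerate} \item For every $P\in\mathcal P^n$, $U^\dagger PU$ is a signed Pauli $Q$ as used in the test, and $|\psi_{in}\rangle$ is always an eigenstate of $Q$ with eigenvalue $\lambda$. \item If $\tilde U$ and $U$ are equal as channels, then the outcome of a run is the predicted value $\lambda$ with probability $1$; hence in any number of runs the probability that some outcome differs from the predicted one is $0$. \item If $\tilde U$ and $U$ are not equal as channels, then the outcome of a run is $-\lambda$ with probability at least $c$, over the choice of $P$, the random signs and the measurement. Consequently, for every $\delta\in(0,1)$ and every integer $k\ge C\log(1/\delta)$, in $k$ independent runs (each using $\tilde U$ once) some outcome differs from the predicted one with probability at least $1-\delta$. \end{enumerate} -/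

import Mathlib

open Matrix MeasureTheory
open scoped ComplexOrder

namespace CliffordTest

/-- Computational basis labels of an `n`-qubit register: bit strings of length `n`. -/
abbrev Bits (n : ℕ) : Type := Fin n → Fin 2

/-- Complex `2ⁿ × 2ⁿ` matrices. -/
abbrev Op (n : ℕ) : Type := Matrix (Bits n) (Bits n) ℂ

/-- The group of `n`-qubit unitaries. -/
abbrev UnitaryOp (n : ℕ) : Type := Matrix.unitaryGroup (Bits n) ℂ

/-- Names of the four one-qubit Paulis. -/
inductive Pauli : Type
  | I | X | Y | Z
  deriving DecidableEq, Inhabited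

instance : Fintype Pauli where
  elems := {.I, .X, .Y, .Z}
  complete p := by cases p <;> simp

/-- The one-qubit Pauli matrices. -/
noncomputable def Pauli.mat : Pauli → Matrix (Fin 2) (Fin 2) ℂ
  | .I => 1
  | .X => !![0, 1; 1, 0]
  | .Y => !![0, -Complex.I; Complex.I, 0]
  | .Z => !![1, 0; 0, -1]

/-- The tensor product `A₁ ⊗ ⋯ ⊗ Aₙ` of one-qubit matrices. -/
noncomputable def tensor {n : ℕ} (A : Fin n → Matrix (Fin 2) (Fin 2) ℂ) : Op n :=
  Matrix.of fun x y => ∏ j, A j (x j) (y j)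

/-- The `n`-qubit Pauli `P₁ ⊗ ⋯ ⊗ Pₙ`. -/
noncomputable def pauliOp {n : ℕ} (P : Fin n → Pauli) : Op n := tensor fun j => (P j).mat

/-- A sign, as a complex number. -/
abbrev sgn (s : ℤˣ) : ℂ := ((s : ℤ) : ℂ)

/-! ### Clifford circuits and Clifford unitaries -/

/-- Elementary Clifford gates on `n` qubits. -/
inductive Gate (n : ℕ) : Type
  | pauli (p : Pauli) (j : Fin n)
  | hadamard (j : Fin n)
  | phase (j : Fin n)
  | cnot (control target : Fin n) (h : control ≠ target)

/-- The one-qubit matrix `A` acting on qubit `j`, and the identity on the other qubits. -/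
noncomputable def onQubit {n : ℕ} (j : Fin n) (A : Matrix (Fin 2) (Fin 2) ℂ) : Op n :=
  tensor (Function.update (fun _ => 1) j A)

/-- The matrix of a gate. -/
noncomputable def Gate.mat {n : ℕ} : Gate n → Op n
  | .pauli p j => onQubit j p.mat
  | .hadamard j => onQubit j
      !![1 / (√2 : ℂ), 1 / (√2 : ℂ); 1 / (√2 : ℂ), -1 / (√2 : ℂ)]
  | .phase j => onQubit j !![1, 0; 0, Complex.I]
  | .cnot c t _ => Matrix.of fun x y =>
      if x = Function.update y t (y t + y c) then 1 else 0

/-- The matrix of a circuit, a list of gates of which the head is applied first. -/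
noncomputable def circuitMat {n : ℕ} (gates : List (Gate n)) : Op n :=
  gates.foldl (fun M g => g.mat * M) 1

/-- Clifford unitaries: conjugation takes each `n`-qubit Pauli to an `n`-qubit Pauli up to sign. -/
def IsClifford {n : ℕ} (U : Op n) : Prop :=
  U ∈ Matrix.unitaryGroup (Bits n) ℂ ∧
    ∀ P : Fin n → Pauli, ∃ (s : ℤˣ) (Q : Fin n → Pauli), U * pauliOp P * Uᴴ = sgn s • pauliOp Q

/-- `U` and `V` are equal as channels: conjugation by them is the same map on density matrices. -/
def SameChannel {n : ℕ} (U V : Op n) : Prop :=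
  ∀ ρ : Op n, ρ.PosSemidef → ρ.trace = 1 → U * ρ * Uᴴ = V * ρ * Vᴴ

/-! ### Pure states and measurement -/

/-- Unit vectors of an `n`-qubit register. -/
def PureState (n : ℕ) : Type := {φ : Bits n → ℂ // ∑ x, ‖φ x‖ ^ 2 = 1}

theorem sum_normSq_eq {n : ℕ} (φ : Bits n → ℂ) :
    ((∑ x, ‖φ x‖ ^ 2 : ℝ) : ℂ) = star φ ⬝ᵥ φ := by
  simp [dotProduct, Complex.conj_mul']

theorem sum_normSq_mulVec {n : ℕ} (U : Op n) (hU : Uᴴ * U = 1) (φ : Bits n → ℂ) :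
    ∑ x, ‖(U *ᵥ φ) x‖ ^ 2 = ∑ x, ‖φ x‖ ^ 2 := by
  have h : star (U *ᵥ φ) ⬝ᵥ (U *ᵥ φ) = star φ ⬝ᵥ φ := by
    rw [star_mulVec, ← dotProduct_mulVec, mulVec_mulVec, hU, one_mulVec]
  rw [← sum_normSq_eq, ← sum_normSq_eq] at h
  exact_mod_cast h

/-- The state `U|φ⟩`. -/
def PureState.apply {n : ℕ} (U : UnitaryOp n) (φ : PureState n) : PureState n :=
  ⟨(U : Op n) *ᵥ φ.1, by
    rw [sum_normSq_mulVec _ (Matrix.mem_unitaryGroup_iff'.1 U.2), φ.2]⟩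

theorem tensor_mul {n : ℕ} (A B : Fin n → Matrix (Fin 2) (Fin 2) ℂ) :
    tensor A * tensor B = tensor fun j => A j * B j := by
  ext x y
  simp only [tensor, Matrix.mul_apply, Matrix.of_apply, ← Finset.prod_mul_distrib]
  rw [Finset.prod_univ_sum, Fintype.piFinset_univ]

theorem tensor_one {n : ℕ} : tensor (fun _ : Fin n => 1) = 1 := by
  ext x y
  simp only [tensor, Matrix.of_apply, Matrix.one_apply, Finset.prod_ite_zero, funext_iff]
  simp

theorem tensor_conjTranspose {n : ℕ} (A : Fin n → Matrix (Fin 2) (Fin 2) ℂ) :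
    (tensor A)ᴴ = tensor fun j => (A j)ᴴ := by
  ext x y
  simp [tensor, Matrix.conjTranspose_apply]

theorem pauliOp_conjTranspose_mul {n : ℕ} (P : Fin n → Pauli) :
    (pauliOp P)ᴴ * pauliOp P = 1 := by
  rw [pauliOp, tensor_conjTranspose, tensor_mul, ← tensor_one]
  congr 1
  funext j
  cases P j <;> ext a b <;> fin_cases a <;> fin_cases b <;>
    simp [Pauli.mat, Matrix.mul_apply, Fin.sum_univ_two]

/-- The projector `(1 + m P) / 2` onto the `m`-eigenspace of the `±1`-valued observable `P`. -/
noncomputable def eigenProj {n : ℕ} (P : Fin n → Pauli) (m : ℤˣ) : Op n :=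
  (1 / 2 : ℂ) • (1 + sgn m • pauliOp P)

/-- Born's rule: measuring the observable `P` on `|φ⟩` gives `m` with probability `‖Π_m φ‖²`. -/
noncomputable def bornProb {n : ℕ} (P : Fin n → Pauli) (φ : PureState n) (m : ℤˣ) : ℝ :=
  ∑ x, ‖(eigenProj P m *ᵥ φ.1) x‖ ^ 2

theorem bornProb_nonneg {n : ℕ} (P : Fin n → Pauli) (φ : PureState n) (m : ℤˣ) :
    0 ≤ bornProb P φ m :=
  Finset.sum_nonneg fun _ _ => by positivity

theorem bornProb_sum {n : ℕ} (P : Fin n → Pauli) (φ : PureState n) :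
    ∑ m, bornProb P φ m = 1 := by
  have h1 := φ.2
  have h2 := sum_normSq_mulVec _ (pauliOp_conjTranspose_mul P) φ.1
  have key : ∀ x, ‖(eigenProj P 1 *ᵥ φ.1) x‖ ^ 2 + ‖(eigenProj P (-1) *ᵥ φ.1) x‖ ^ 2 =
      (‖φ.1 x‖ ^ 2 + ‖(pauliOp P *ᵥ φ.1) x‖ ^ 2) / 2 := by
    intro x
    have e1 : (eigenProj P 1 *ᵥ φ.1) x = (1 / 2 : ℂ) * (φ.1 x + (pauliOp P *ᵥ φ.1) x) := by
      simp [eigenProj, smul_mulVec, add_mulVec, sgn, mul_add]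
    have e2 : (eigenProj P (-1) *ᵥ φ.1) x = (1 / 2 : ℂ) * (φ.1 x - (pauliOp P *ᵥ φ.1) x) := by
      simp [eigenProj, smul_mulVec, add_mulVec, neg_mulVec, sgn, sub_eq_add_neg, mul_add]
    rw [e1, e2, norm_mul, norm_mul, mul_pow, mul_pow]
    have := parallelogram_law_with_norm ℝ (φ.1 x) ((pauliOp P *ᵥ φ.1) x)
    norm_num
    nlinarith
  have hu : (Finset.univ : Finset ℤˣ) = {1, -1} := rfl
  rw [hu, Finset.sum_pair (by decide)]
  simp only [bornProb]
  rw [← Finset.sum_add_distrib, Finset.sum_congr rfl fun x _ => key x, ← Finset.sum_div,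
    Finset.sum_add_distrib, h2, h1]
  norm_num

/-- The distribution of the outcome when the observable `P` is measured on `|φ⟩`. -/
noncomputable def measurePauli {n : ℕ} (P : Fin n → Pauli) (φ : PureState n) : PMF ℤˣ :=
  PMF.ofFintype (fun m => ENNReal.ofReal (bornProb P φ m)) (by
    rw [← ENNReal.ofReal_sum_of_nonneg fun m _ => bornProb_nonneg P φ m, bornProb_sum, ENNReal.ofReal_one])

/-! ### The test -/

/-- The state prepared on a qubit where `Q` acts by the Pauli `q`: for `q ∈ {X, Y, Z}` the
`σ`-eigenstate of `q`, for `q = I` the state `(|0⟩ + e^{iπ/4}|1⟩)/√2` (whatever `σ` is). -/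
noncomputable def qubitState : Pauli → ℤˣ → Fin 2 → ℂ
  | .I, _ => ![1 / (√2 : ℂ), Complex.exp (Complex.I * Real.pi / 4) / (√2 : ℂ)]
  | .X, σ => ![1 / (√2 : ℂ), sgn σ / (√2 : ℂ)]
  | .Y, σ => ![1 / (√2 : ℂ), sgn σ * Complex.I / (√2 : ℂ)]
  | .Z, σ => if σ = 1 then ![1, 0] else ![0, 1]

theorem qubitState_norm (q : Pauli) (σ : ℤˣ) : ∑ b, ‖qubitState q σ b‖ ^ 2 = 1 := by
  have hs : ‖(√2 : ℂ)‖ ^ 2 = 2 := by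
    rw [Complex.norm_real, Real.norm_eq_abs, sq_abs, Real.sq_sqrt (by norm_num)]
  have he : ‖Complex.exp (Complex.I * Real.pi / 4)‖ = 1 := by
    have : Complex.I * Real.pi / 4 = ((Real.pi / 4 : ℝ) : ℂ) * Complex.I := by
      push_cast; ring
    rw [this, Complex.norm_exp_ofReal_mul_I]
  rcases Int.units_eq_one_or σ with rfl | rfl <;> cases q <;>
    simp only [qubitState, Fin.sum_univ_two, Matrix.cons_val_zero, Matrix.cons_val_one, norm_div,
      div_pow, hs, he, norm_mul] <;> norm_num

/-- The product state `|ψ_in⟩` prepared for the Pauli string `Q` and the random signs `σ`. -/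
noncomputable def inputState {n : ℕ} (Q : Fin n → Pauli) (σ : Fin n → ℤˣ) : PureState n :=
  ⟨fun x => ∏ j, qubitState (Q j) (σ j) (x j), by
    simp only [norm_prod, ← Finset.prod_pow]
    have h := Finset.prod_univ_sum (fun _ : Fin n => (Finset.univ : Finset (Fin 2)))
      (fun j b => ‖qubitState (Q j) (σ j) b‖ ^ 2)
    rw [Fintype.piFinset_univ] at h
    rw [← h]
    exact Finset.prod_eq_one fun j _ => qubitState_norm (Q j) (σ j)⟩

/-- The sign `s` and the string `Q₁, …, Qₙ` with `U† P U = s Q₁ ⊗ ⋯ ⊗ Qₙ`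
(unique if they exist, which they do for Clifford `U`). -/
noncomputable def pullback {n : ℕ} (U : Op n) (P : Fin n → Pauli) : ℤˣ × (Fin n → Pauli) :=
  Classical.epsilon fun r => Uᴴ * pauliOp P * U = sgn r.1 • pauliOp r.2

/-- The eigenvalue of `s Q₁ ⊗ ⋯ ⊗ Qₙ` on the input state prepared for `Q` and `σ`. -/
def predicted {n : ℕ} (r : ℤˣ × (Fin n → Pauli)) (σ : Fin n → ℤˣ) : ℤˣ :=
  r.1 * ∏ j, if r.2 j = .I then 1 else σ j

/-- One run of the test: draw a uniformly random Pauli `P`, compute `U† P U = s Q₁ ⊗ ⋯ ⊗ Qₙ`,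
prepare the input state with uniformly random signs, run `V` on it once, measure `P`.
The result is the pair (predicted value `λ`, observed outcome). -/
noncomputable def test {n : ℕ} (U V : UnitaryOp n) : PMF (ℤˣ × ℤˣ) :=
  (PMF.uniformOfFintype (Fin n → Pauli)).bind fun P =>
    (PMF.uniformOfFintype (Fin n → ℤˣ)).bind fun σ =>
      (measurePauli P ((inputState (pullback (U : Op n) P).2 σ).apply V)).map fun m =>
        (predicted (pullback (U : Op n) P) σ, m)

instance : MeasurableSingletonClass ℤˣ where
  measurableSet_singleton s :=
    ⟨{(s : ℤ)}, measurableSet_singleton _, by ext t; simp [Units.ext_iff]⟩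

/-- The joint distribution of `k` independent runs of the test. -/
noncomputable def repeatedTest {n : ℕ} (U V : UnitaryOp n) (k : ℕ) :
    Measure (Fin k → ℤˣ × ℤˣ) :=
  Measure.pi fun _ => (test U V).toMeasure

/-- The event that a difference is detected: some run has an outcome other than predicted. -/
def detected (k : ℕ) : Set (Fin k → ℤˣ × ℤˣ) := {ω | ∃ i, (ω i).2 ≠ (ω i).1}

end CliffordTest

open CliffordTest

/-!
Conjugation by `U†` and by `V†` agree on a subalgebra of the observables. If the channels differ,
this subalgebra is proper, so it misses some Pauli `R`; it then misses `P` or `R P` for every Pauli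
`P`, hence at least half of the Paulis.

Let `P` be such a Pauli, with pullbacks `s Q` under `U` and `s' Q'` under `V`. Averaged over the
random signs, `λ` times the expected outcome is `s s'` times a product over the qubits. A factor
with `Q_j = Q'_j` is `1`. A factor with `Q_j ≠ Q'_j` vanishes if `Q_j ≠ I`, since the signed average
of the two eigenprojectors of `Q_j` is `Q_j / 2`, which is trace-orthogonal to `Q'_j`; if `Q_j = I`
it is at most `1/√2`, since the Bloch vector of the fixed state is `(1/√2, 1/√2, 0)`. So the average
is at most `1/√2` if `Q ≠ Q'`, and it is `-1` if `Q = Q'`, because then `s ≠ s'`. The outcome is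
therefore `-λ` with probability at least `(1 - 1/√2)/2` for this `P`, and at least `(1 - 1/√2)/4`
overall.
-/

namespace CliffordTest

open scoped BigOperators

variable {n : ℕ}

theorem expect_prod_eq_prod_expect {ι κ K : Type*} [Fintype ι] [DecidableEq ι] [Fintype κ]
    [Field K] [CharZero K] (f : ι → κ → K) : 𝔼 x : ι → κ, ∏ i, f i (x i) = ∏ i, 𝔼 k, f i k := by
  simp only [Fintype.expect_eq_sum_div_card, Fintype.prod_sum, Finset.prod_div_distrib,
    Finset.prod_const, Fintype.card_fun, Nat.cast_pow, Finset.card_univ]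

/-! ### Tensor products -/

/-- The product vector `φ₁ ⊗ ⋯ ⊗ φₙ`. -/
def tensorVec (φ : Fin n → Fin 2 → ℂ) : Bits n → ℂ := fun x ↦ ∏ j, φ j (x j)

theorem tensor_smul (c : Fin n → ℂ) (A : Fin n → Matrix (Fin 2) (Fin 2) ℂ) :
    tensor (fun j ↦ c j • A j) = (∏ j, c j) • tensor A := by
  ext x y
  simp [tensor, Finset.prod_mul_distrib]

theorem trace_tensor (A : Fin n → Matrix (Fin 2) (Fin 2) ℂ) :
    (tensor A).trace = ∏ j, (A j).trace :=
  (Fintype.prod_sum fun j a ↦ A j a a).symm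

theorem tensor_mulVec_tensorVec (A : Fin n → Matrix (Fin 2) (Fin 2) ℂ) (φ : Fin n → Fin 2 → ℂ) :
    tensor A *ᵥ tensorVec φ = tensorVec fun j ↦ A j *ᵥ φ j := by
  ext x
  simp only [tensor, tensorVec, mulVec, dotProduct, of_apply, ← Finset.prod_mul_distrib]
  exact (Fintype.prod_sum fun j a ↦ A j (x j) a * φ j a).symm

theorem star_tensorVec_dotProduct_tensorVec (φ χ : Fin n → Fin 2 → ℂ) :
    star (tensorVec φ) ⬝ᵥ tensorVec χ = ∏ j, star (φ j) ⬝ᵥ χ j := by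
  simp only [tensorVec, dotProduct, Pi.star_apply, star_prod, ← Finset.prod_mul_distrib]
  exact (Fintype.prod_sum fun j a ↦ star (φ j a) * χ j a).symm

theorem tensorVec_smul (c : Fin n → ℂ) (φ : Fin n → Fin 2 → ℂ) :
    tensorVec (fun j ↦ c j • φ j) = (∏ j, c j) • tensorVec φ := by
  ext x
  simp [tensorVec, Finset.prod_mul_distrib]

/-! ### The Pauli basis -/

theorem sgn_mul (s t : ℤˣ) : sgn (s * t) = sgn s * sgn t := by simp [sgn]

theorem sgn_mul_self (s : ℤˣ) : sgn s * sgn s = 1 := by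
  rw [← sgn_mul, Int.units_mul_self, sgn, Units.val_one, Int.cast_one]

theorem sgn_neg (s : ℤˣ) : sgn (-s) = -sgn s := by simp [sgn]

theorem norm_sgn (s : ℤˣ) : ‖sgn s‖ = 1 := by
  rcases Int.units_eq_one_or s with rfl | rfl <;> simp [sgn]

theorem sgn_prod {ι : Type*} [Fintype ι] (s : ι → ℤˣ) : sgn (∏ j, s j) = ∏ j, sgn (s j) := by
  simp [sgn, Units.coe_prod]

theorem Pauli.conjTranspose_mat (p : Pauli) : p.matᴴ = p.mat := by
  cases p <;> ext a b <;> fin_cases a <;> fin_cases b <;> simp [Pauli.mat]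

theorem Pauli.mat_mul_self (p : Pauli) : p.mat * p.mat = 1 := by
  cases p <;> simp [Pauli.mat, one_fin_two]

theorem Pauli.trace_mat_mul (p q : Pauli) : (p.mat * q.mat).trace = if p = q then 2 else 0 := by
  cases p <;> cases q <;> simp [Pauli.mat, one_fin_two] <;> norm_num

/-- The product of two one-qubit Paulis, up to phase. -/
def Pauli.mul : Pauli → Pauli → Pauli
  | .I, q => q
  | p, .I => p
  | .X, .X | .Y, .Y | .Z, .Z => .I
  | .X, .Y | .Y, .X => .Z
  | .Y, .Z | .Z, .Y => .X
  | .Z, .X | .X, .Z => .Y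

theorem Pauli.mul_involutive (p : Pauli) : Function.Involutive p.mul := by
  intro q
  revert p q
  decide

theorem Pauli.exists_mat_mul_mat (p q : Pauli) : ∃ c : ℂ, p.mat * q.mat = c • (p.mul q).mat := by
  use (p.mat * q.mat * (p.mul q).mat).trace / 2
  cases p <;> cases q <;> simp [Pauli.mat, Pauli.mul, one_fin_two]

theorem conjTranspose_pauliOp (P : Fin n → Pauli) : (pauliOp P)ᴴ = pauliOp P := by
  simp only [pauliOp, tensor_conjTranspose, Pauli.conjTranspose_mat]

theorem pauliOp_mul_self (P : Fin n → Pauli) : pauliOp P * pauliOp P = 1 := by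
  simp only [pauliOp, tensor_mul, Pauli.mat_mul_self, tensor_one]

theorem exists_pauliOp_mul_pauliOp (P Q : Fin n → Pauli) :
    ∃ c : ℂ, pauliOp P * pauliOp Q = c • pauliOp fun j ↦ (P j).mul (Q j) := by
  choose c hc using fun j ↦ (P j).exists_mat_mul_mat (Q j)
  exact ⟨∏ j, c j, by simp only [pauliOp, tensor_mul, hc, tensor_smul]⟩

theorem trace_pauliOp_mul_of_ne {P Q : Fin n → Pauli} (h : P ≠ Q) :
    (pauliOp P * pauliOp Q).trace = 0 := by
  obtain ⟨j, hj⟩ := Function.ne_iff.1 h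
  rw [pauliOp, pauliOp, tensor_mul, trace_tensor]
  exact Finset.prod_eq_zero (Finset.mem_univ j) ((Pauli.trace_mat_mul _ _).trans (if_neg hj))

theorem linearIndependent_pauliOp : LinearIndependent ℂ (pauliOp (n := n)) := by
  refine LinearMap.linearIndependent_of_isOrthoᵢ
    (B := (LinearMap.mul ℂ (Op n)).compr₂ (traceLinearMap (Bits n) ℂ ℂ))
    (fun P Q h ↦ trace_pauliOp_mul_of_ne h) fun P ↦ ?_
  simp [pauliOp_mul_self]

theorem span_range_pauliOp : Submodule.span ℂ (Set.range (pauliOp (n := n))) = ⊤ := by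
  refine linearIndependent_pauliOp.span_eq_top_of_card_eq_finrank' ?_
  have card_pauli : Fintype.card Pauli = 4 := rfl
  simp [Module.finrank_matrix, card_pauli, ← mul_pow]

/-- If the Pauli `R` is not in `S`, then of `P` and `R * P` at least one is not in `S`: at least
half of the Paulis lie outside of `S`. -/
theorem half_le_expect_of_pauliOp_notMem {S : Subalgebra ℂ (Op n)} (hS : S ≠ ⊤)
    {f : (Fin n → Pauli) → ℝ} (hf : ∀ P, 0 ≤ f P) {a : ℝ} (ha : ∀ P, pauliOp P ∉ S → a ≤ f P) :
    a / 2 ≤ 𝔼 P, f P := by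
  obtain ⟨R, hR⟩ : ∃ R, pauliOp R ∉ S := by
    by_contra! h
    refine hS (Algebra.toSubmodule_eq_top.1 (top_unique ?_))
    rw [← span_range_pauliOp, Submodule.span_le]
    exact Set.range_subset_iff.2 h
  set RP : (Fin n → Pauli) → (Fin n → Pauli) := fun P j ↦ (R j).mul (P j)
  have RP_involutive : Function.Involutive RP := fun P ↦
    funext fun j ↦ (R j).mul_involutive (P j)
  have expect_RP : 𝔼 P, f (RP P) = 𝔼 P, f P :=
    Fintype.expect_bijective RP RP_involutive.bijective _ _ fun _ ↦ rfl
  have notMem_or (P) : pauliOp P ∉ S ∨ pauliOp (RP P) ∉ S := by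
    by_contra! h
    obtain ⟨c, hc⟩ := exists_pauliOp_mul_pauliOp R P
    have : pauliOp R = c • pauliOp (RP P) * pauliOp P := by
      rw [← hc, Matrix.mul_assoc, pauliOp_mul_self, Matrix.mul_one]
    exact hR (this ▸ S.mul_mem (S.smul_mem h.2 c) h.1)
  have le_add (P) : a ≤ f P + f (RP P) := by
    rcases notMem_or P with h | h
    · linarith [ha _ h, hf (RP P)]
    · linarith [ha _ h, hf P]
  have le_expect_add : a ≤ 𝔼 P, (f P + f (RP P)) :=
    Finset.le_expect Finset.univ_nonempty fun P _ ↦ le_add P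
  rw [Finset.expect_add_distrib, expect_RP] at le_expect_add
  linarith

/-! ### Clifford unitaries -/

/-- The one-qubit case of `IsClifford`, for matrices indexed by `Fin 2`. -/
def IsOneQubitClifford (A : Matrix (Fin 2) (Fin 2) ℂ) : Prop :=
  A * Aᴴ = 1 ∧ ∀ p : Pauli, ∃ (s : ℤˣ) (q : Pauli), A * p.mat * Aᴴ = sgn s • q.mat

theorem isOneQubitClifford_one : IsOneQubitClifford 1 :=
  ⟨by simp, fun p ↦ ⟨1, p, by simp [sgn]⟩⟩

theorem isOneQubitClifford_pauli (p : Pauli) : IsOneQubitClifford p.mat := by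
  refine ⟨by rw [p.conjTranspose_mat, p.mat_mul_self], fun q ↦ ?_⟩
  refine ⟨if p = .I ∨ q = .I ∨ p = q then 1 else -1, q, ?_⟩
  rw [p.conjTranspose_mat]
  cases p <;> cases q <;> simp [sgn, Pauli.mat, one_fin_two]

theorem inv_sqrt_two_mul_self : ((√2 : ℝ) : ℂ)⁻¹ * ((√2 : ℝ) : ℂ)⁻¹ = 2⁻¹ := by
  rw [← mul_inv, ← Complex.ofReal_mul, Real.mul_self_sqrt zero_le_two, Complex.ofReal_ofNat]

theorem isOneQubitClifford_hadamard : IsOneQubitClifford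
    !![1 / (√2 : ℂ), 1 / (√2 : ℂ); 1 / (√2 : ℂ), -1 / (√2 : ℂ)] := by
  have h := inv_sqrt_two_mul_self
  constructor
  · ext a b
    fin_cases a <;> fin_cases b <;> simp [mul_apply, neg_div, h] <;> norm_num
  · intro p
    use if p = .Y then -1 else 1, match p with | .I => .I | .X => .Z | .Y => .Y | .Z => .X
    have mul_I_mul (z : ℂ) : z * Complex.I * z = z * z * Complex.I := by ring
    cases p <;> ext a b <;> fin_cases a <;> fin_cases b <;>
      simp [Pauli.mat, mul_apply, Fin.sum_univ_two, sgn, neg_div, h, mul_I_mul] <;> ring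

theorem isOneQubitClifford_phase : IsOneQubitClifford !![1, 0; 0, Complex.I] := by
  constructor
  · ext a b
    fin_cases a <;> fin_cases b <;> simp [mul_apply]
  · intro p
    use if p = .Y then -1 else 1, match p with | .I => .I | .X => .Y | .Y => .X | .Z => .Z
    cases p <;> ext a b <;> fin_cases a <;> fin_cases b <;>
      simp [Pauli.mat, mul_apply, Fin.sum_univ_two, sgn]

theorem isClifford_tensor {A : Fin n → Matrix (Fin 2) (Fin 2) ℂ}
    (hA : ∀ j, IsOneQubitClifford (A j)) : IsClifford (tensor A) := by
  constructor
  · rw [mem_unitaryGroup_iff, star_eq_conjTranspose, tensor_conjTranspose, tensor_mul]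
    simp only [(hA _).1, tensor_one]
  · intro P
    choose s Q hQ using fun j ↦ (hA j).2 (P j)
    refine ⟨∏ j, s j, Q, ?_⟩
    simp only [pauliOp, tensor_conjTranspose, tensor_mul, hQ, tensor_smul, sgn_prod]

theorem isClifford_onQubit (j : Fin n) {A : Matrix (Fin 2) (Fin 2) ℂ}
    (hA : IsOneQubitClifford A) : IsClifford (onQubit j A) := by
  refine isClifford_tensor fun i ↦ ?_
  rcases eq_or_ne i j with rfl | hij
  · rwa [Function.update_self]
  · rw [Function.update_of_ne hij]
    exact isOneQubitClifford_one

/-- The permutation of basis labels that a CNOT gate performs. -/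
def cnotPerm (c t : Fin n) (x : Bits n) : Bits n := Function.update x t (x t + x c)

theorem cnotPerm_involutive {c t : Fin n} (h : c ≠ t) : Function.Involutive (cnotPerm c t) := by
  intro x
  have add_add_self (a b : Fin 2) : a + b + b = a := by revert a b; decide
  simp [cnotPerm, h, add_add_self]

theorem cnot_conj_apply {c t : Fin n} (h : c ≠ t) (M : Op n) (x y : Bits n) :
    ((Gate.cnot c t h).mat * M * (Gate.cnot c t h).matᴴ) x y =
      M (cnotPerm c t x) (cnotPerm c t y) := by
  have mat_apply (x y) : (Gate.cnot c t h).mat x y = if cnotPerm c t x = y then 1 else 0 := by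
    simp only [(cnotPerm_involutive h).eq_iff]
    rfl
  simp [mul_apply, mat_apply, apply_ite]

/-- CNOT propagates `X` from the control, which carries `p`, to the target, which carries `q`, and
`Z` from the target to the control. -/
theorem Pauli.cnot_conj (p q : Pauli) (a a' b b' : Fin 2) :
    p.mat a a' * q.mat (b + a) (b' + a') =
      sgn (if p = .X ∧ q = .Z ∨ p = .Y ∧ q = .Y then -1 else 1) *
        ((p.mul (if q = .Y ∨ q = .Z then .Z else .I)).mat a a' *
          ((if p = .X ∨ p = .Y then Pauli.X else .I).mul q).mat b b') := by
  revert a a' b b'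
  cases p <;> cases q <;>
    simp [Fin.forall_fin_two, Pauli.mul, Pauli.mat, one_fin_two, sgn]

theorem isClifford_cnot {c t : Fin n} (h : c ≠ t) : IsClifford (Gate.cnot c t h).mat := by
  constructor
  · rw [mem_unitaryGroup_iff, star_eq_conjTranspose]
    ext x y
    have conj_one := cnot_conj_apply h 1 x y
    rw [Matrix.mul_one] at conj_one
    simp only [conj_one, one_apply, (cnotPerm_involutive h).injective.eq_iff]
  · intro P
    obtain ⟨s, p', q', hs⟩ : ∃ (s : ℤˣ) (p' q' : Pauli), ∀ a a' b b' : Fin 2,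
        (P c).mat a a' * (P t).mat (b + a) (b' + a') = sgn s * (p'.mat a a' * q'.mat b b') :=
      ⟨_, _, _, (P c).cnot_conj (P t)⟩
    refine ⟨s, Function.update (Function.update P c p') t q', ?_⟩
    ext x y
    have split_prod (f : Fin n → ℂ) : ∏ j, f j = f c * f t * ∏ j ∈ {c, t}ᶜ, f j := by
      rw [← Finset.prod_pair h, Finset.prod_mul_prod_compl]
    have off_pair : ∀ j ∈ ({c, t} : Finset (Fin n))ᶜ,
        (P j).mat (cnotPerm c t x j) (cnotPerm c t y j) =
          (Function.update (Function.update P c p') t q' j).mat (x j) (y j) := by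
      intro j hj
      simp only [Finset.mem_compl, Finset.mem_insert, Finset.mem_singleton, not_or] at hj
      simp [cnotPerm, hj]
    rw [cnot_conj_apply, Matrix.smul_apply, smul_eq_mul]
    simp only [pauliOp, tensor, of_apply]
    rw [split_prod, split_prod, Finset.prod_congr rfl off_pair]
    simp [cnotPerm, h, hs, mul_assoc]

theorem isClifford_one : IsClifford (1 : Op n) :=
  ⟨one_mem _, fun P ↦ ⟨1, P, by simp [sgn]⟩⟩

theorem IsClifford.mul {U V : Op n} (hU : IsClifford U) (hV : IsClifford V) :
    IsClifford (U * V) := by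
  refine ⟨mul_mem hU.1 hV.1, fun P ↦ ?_⟩
  obtain ⟨s, Q, hQ⟩ := hV.2 P
  obtain ⟨t, R, hR⟩ := hU.2 Q
  refine ⟨s * t, R, ?_⟩
  calc U * V * pauliOp P * (U * V)ᴴ
      = U * (V * pauliOp P * Vᴴ) * Uᴴ := by simp only [conjTranspose_mul, Matrix.mul_assoc]
    _ = sgn (s * t) • pauliOp R := by
      rw [hQ, Matrix.mul_smul, Matrix.smul_mul, hR, smul_smul, sgn_mul]

theorem conjTranspose_mul_conj_mul {m R : Type*} [Fintype m] [DecidableEq m] [CommRing R]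
    [StarRing R] {U : Matrix m m R} (hU : U ∈ unitaryGroup m R) (M : Matrix m m R) :
    Uᴴ * (U * M * Uᴴ) * U = M := by
  have h : Uᴴ * U = 1 := mem_unitaryGroup_iff'.1 hU
  calc Uᴴ * (U * M * Uᴴ) * U = Uᴴ * U * M * (Uᴴ * U) := by simp only [Matrix.mul_assoc]
    _ = M := by rw [h, Matrix.one_mul, Matrix.mul_one]

/-- Conjugation by `U` permutes the finitely many signed Paulis, because it is injective. -/
theorem IsClifford.conjTranspose {U : Op n} (hU : IsClifford U) : IsClifford Uᴴ := by
  choose s F hF using hU.2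
  have eq_smul_conj (R) : Uᴴ * pauliOp (F R) * U = sgn (s R) • pauliOp R := by
    rw [← conjTranspose_mul_conj_mul hU.1 (pauliOp R), hF, Matrix.mul_smul, Matrix.smul_mul,
      smul_smul, sgn_mul_self, one_smul]
  have F_injective : Function.Injective F := fun R R' h ↦
    linearIndependent_pauliOp.eq_of_smul_apply_eq_smul_apply (sgn (s R)) (sgn (s R')) R R'
      (left_ne_zero_of_mul_eq_one (sgn_mul_self _)) (by rw [← eq_smul_conj, h, eq_smul_conj])
  refine ⟨Unitary.star_mem hU.1, fun P ↦ ?_⟩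
  obtain ⟨R, rfl⟩ := Finite.surjective_of_injective F_injective P
  exact ⟨s R, R, by rw [conjTranspose_conjTranspose, eq_smul_conj]⟩

theorem Gate.isClifford_mat : ∀ g : Gate n, IsClifford g.mat
  | .pauli p j => isClifford_onQubit j (isOneQubitClifford_pauli p)
  | .hadamard j => isClifford_onQubit j isOneQubitClifford_hadamard
  | .phase j => isClifford_onQubit j isOneQubitClifford_phase
  | .cnot _ _ h => isClifford_cnot h

theorem isClifford_circuitMat (gates : List (Gate n)) : IsClifford (circuitMat gates) :=
  List.foldlRecOn gates _ isClifford_one fun _ hM g _ ↦ g.isClifford_mat.mul hM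

theorem IsClifford.pullback_spec {U : Op n} (hU : IsClifford U) (P : Fin n → Pauli) :
    Uᴴ * pauliOp P * U = sgn (pullback U P).1 • pauliOp (pullback U P).2 := by
  obtain ⟨s, Q, h⟩ := hU.conjTranspose.2 P
  rw [conjTranspose_conjTranspose] at h
  exact Classical.epsilon_spec
    (p := fun r : ℤˣ × (Fin n → Pauli) ↦ Uᴴ * pauliOp P * U = sgn r.1 • pauliOp r.2) ⟨(s, Q), h⟩

/-! ### Observables on which two unitaries agree -/

/-- The observables on which conjugation by `U†` and by `V†` agree: those with the same Heisenberg
evolution under `U` and `V`. -/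
noncomputable def agreeingObservables (U V : UnitaryOp n) : Subalgebra ℂ (Op n) :=
  AlgHom.equalizer (Unitary.conjStarAlgAut ℂ (Op n) (star U) : Op n →ₐ[ℂ] Op n)
    (Unitary.conjStarAlgAut ℂ (Op n) (star V) : Op n →ₐ[ℂ] Op n)

theorem mem_agreeingObservables {U V : UnitaryOp n} {M : Op n} :
    M ∈ agreeingObservables U V ↔
      (U : Op n)ᴴ * M * (U : Op n) = (V : Op n)ᴴ * M * (V : Op n) := by
  simp [agreeingObservables, AlgHom.mem_equalizer, star_eq_conjTranspose]

theorem sameChannel_of_agreeingObservables_eq_top {U V : UnitaryOp n}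
    (h : agreeingObservables U V = ⊤) : SameChannel (U : Op n) (V : Op n) := by
  intro ρ _ _
  have hρ := mem_agreeingObservables.1 (h ▸ Algebra.mem_top :
    (U : Op n) * ρ * (U : Op n)ᴴ ∈ agreeingObservables U V)
  rw [conjTranspose_mul_conj_mul U.2] at hρ
  have conj_conj := conjTranspose_mul_conj_mul (Unitary.star_mem V.2)
    ((U : Op n) * ρ * (U : Op n)ᴴ)
  rw [star_eq_conjTranspose, conjTranspose_conjTranspose, ← hρ] at conj_conj
  exact conj_conj.symm

/-! ### Expectation values and Born probabilities -/

/-- The expectation value `⟨φ|M|φ⟩`. -/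
def expectation {m : Type*} [Fintype m] (M : Matrix m m ℂ) (φ : m → ℂ) : ℂ := star φ ⬝ᵥ M *ᵥ φ

section Expectation

variable {m : Type*} [Fintype m]

theorem expectation_mulVec (M V : Matrix m m ℂ) (φ : m → ℂ) :
    expectation M (V *ᵥ φ) = expectation (Vᴴ * M * V) φ := by
  rw [expectation, expectation, star_mulVec, ← dotProduct_mulVec, mulVec_mulVec, mulVec_mulVec,
    Matrix.mul_assoc]

theorem expectation_eq_trace (M : Matrix m m ℂ) (φ : m → ℂ) :
    expectation M φ = (M * vecMulVec φ (star φ)).trace := by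
  rw [mul_vecMulVec, trace_vecMulVec, dotProduct_comm, expectation]

theorem expectation_smul (c : ℂ) (M : Matrix m m ℂ) (φ : m → ℂ) :
    expectation (c • M) φ = c * expectation M φ := by
  rw [expectation, smul_mulVec, dotProduct_smul, smul_eq_mul, expectation]

theorem expectation_of_mulVec_eq_smul {M : Matrix m m ℂ} {φ : m → ℂ} (hφ : star φ ⬝ᵥ φ = 1) {c : ℂ}
    (h : M *ᵥ φ = c • φ) : expectation M φ = c := by
  rw [expectation, h, dotProduct_smul, hφ, smul_eq_mul, mul_one]

end Expectation

theorem expectation_tensor_tensorVec (A : Fin n → Matrix (Fin 2) (Fin 2) ℂ)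
    (φ : Fin n → Fin 2 → ℂ) :
    expectation (tensor A) (tensorVec φ) = ∏ j, expectation (A j) (φ j) := by
  simp only [expectation, tensor_mulVec_tensorVec, star_tensorVec_dotProduct_tensorVec]

theorem PureState.star_dotProduct_self (ψ : PureState n) : star ψ.1 ⬝ᵥ ψ.1 = 1 := by
  rw [← sum_normSq_eq, ψ.2, Complex.ofReal_one]

theorem conjTranspose_eigenProj (P : Fin n → Pauli) (m : ℤˣ) :
    (eigenProj P m)ᴴ = eigenProj P m := by
  simp [eigenProj, conjTranspose_pauliOp, sgn]

theorem eigenProj_mul_self (P : Fin n → Pauli) (m : ℤˣ) :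
    eigenProj P m * eigenProj P m = eigenProj P m := by
  simp only [eigenProj, Matrix.smul_mul, Matrix.mul_smul, mul_add, add_mul, Matrix.one_mul,
    Matrix.mul_one, pauliOp_mul_self]
  match_scalars
  · linear_combination (1 / 4) * sgn_mul_self m
  · ring

theorem bornProb_eq_expectation (P : Fin n → Pauli) (φ : PureState n) (m : ℤˣ) :
    bornProb P φ m = (1 + (sgn m * expectation (pauliOp P) φ.1).re) / 2 := by
  have bornProb_eq_ofReal : (bornProb P φ m : ℂ) =
      ((1 / 2 : ℝ) : ℂ) * (1 + sgn m * expectation (pauliOp P) φ.1) := by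
    rw [bornProb, sum_normSq_eq, star_mulVec, ← dotProduct_mulVec, mulVec_mulVec,
      conjTranspose_eigenProj, eigenProj_mul_self, eigenProj, smul_mulVec, add_mulVec, one_mulVec,
      smul_mulVec, dotProduct_smul, dotProduct_add, dotProduct_smul, φ.star_dotProduct_self,
      expectation, smul_eq_mul, smul_eq_mul]
    norm_num
  rw [← Complex.ofReal_re (bornProb P φ m), bornProb_eq_ofReal, Complex.re_ofReal_mul,
    Complex.add_re, Complex.one_re]
  ring

theorem SameChannel.expectation_eq {U V : Op n} (h : SameChannel U V) (M : Op n)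
    (ψ : PureState n) : expectation M (U *ᵥ ψ.1) = expectation M (V *ᵥ ψ.1) := by
  have projector_eq := h _ (posSemidef_vecMulVec_self_star ψ.1) <| by
    rw [trace_vecMulVec, dotProduct_comm, ψ.star_dotProduct_self]
  simp only [mul_vecMulVec, vecMulVec_mul, ← star_mulVec] at projector_eq
  rw [expectation_eq_trace, expectation_eq_trace, projector_eq]

/-! ### The input states -/

/-- The eigenvalue of the Pauli `q` on `qubitState q σ`. -/
def qubitEigenvalue (q : Pauli) (σ : ℤˣ) : ℤˣ := if q = .I then 1 else σ

theorem mat_mulVec_qubitState (q : Pauli) (σ : ℤˣ) :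
    q.mat *ᵥ qubitState q σ = sgn (qubitEigenvalue q σ) • qubitState q σ := by
  rcases Int.units_eq_one_or σ with rfl | rfl <;> cases q <;> ext b <;> fin_cases b <;>
    simp [Pauli.mat, qubitState, qubitEigenvalue, sgn, div_eq_mul_inv] <;> grind [Complex.I_mul_I]

theorem inputState_eq_tensorVec (Q : Fin n → Pauli) (σ : Fin n → ℤˣ) :
    (inputState Q σ).1 = tensorVec fun j ↦ qubitState (Q j) (σ j) := rfl

theorem predicted_eq (r : ℤˣ × (Fin n → Pauli)) (σ : Fin n → ℤˣ) :
    predicted r σ = r.1 * ∏ j, qubitEigenvalue (r.2 j) (σ j) := rfl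

theorem pauliOp_mulVec_inputState (Q : Fin n → Pauli) (σ : Fin n → ℤˣ) :
    pauliOp Q *ᵥ (inputState Q σ).1 =
      sgn (∏ j, qubitEigenvalue (Q j) (σ j)) • (inputState Q σ).1 := by
  simp only [pauliOp, inputState_eq_tensorVec, tensor_mulVec_tensorVec, mat_mulVec_qubitState,
    tensorVec_smul, sgn_prod]

theorem IsClifford.conj_mulVec_inputState {U : Op n} (hU : IsClifford U) (P : Fin n → Pauli)
    (σ : Fin n → ℤˣ) :
    (Uᴴ * pauliOp P * U) *ᵥ (inputState (pullback U P).2 σ).1 =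
      sgn (predicted (pullback U P) σ) • (inputState (pullback U P).2 σ).1 := by
  rw [hU.pullback_spec, smul_mulVec, pauliOp_mulVec_inputState, smul_smul, ← sgn_mul, predicted_eq]

theorem bornProb_predicted_of_sameChannel {U V : UnitaryOp n} (hU : IsClifford (U : Op n))
    (h : SameChannel (U : Op n) (V : Op n)) (P : Fin n → Pauli) (σ : Fin n → ℤˣ) :
    bornProb P ((inputState (pullback (U : Op n) P).2 σ).apply V)
      (predicted (pullback (U : Op n) P) σ) = 1 := by
  rw [bornProb_eq_expectation, PureState.apply, ← h.expectation_eq, expectation_mulVec,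
    expectation_of_mulVec_eq_smul (PureState.star_dotProduct_self _)
      (hU.conj_mulVec_inputState P σ), sgn_mul_self]
  norm_num

/-! ### Overlaps of the input states with Paulis -/

/-- The average over the random sign `σ` of the expectation value of `q'` in `qubitState q σ`,
weighted by the eigenvalue of `q`. -/
noncomputable def overlap (q q' : Pauli) : ℂ :=
  𝔼 σ, sgn (qubitEigenvalue q σ) * expectation q'.mat (qubitState q σ)

theorem expect_units_int {M : Type*} [AddCommMonoid M] [Module ℚ≥0 M] (f : ℤˣ → M) :
    𝔼 σ, f σ = (2⁻¹ : ℚ≥0) • (f 1 + f (-1)) := by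
  have univ_units_int : (Finset.univ : Finset ℤˣ) = {1, -1} := rfl
  simp [Finset.expect, univ_units_int]

theorem exp_I_mul_pi_div_four :
    Complex.exp (Complex.I * Real.pi / 4) = (√2 : ℂ)⁻¹ * (1 + Complex.I) := by
  have : Complex.I * Real.pi / 4 = ((Real.pi / 4 : ℝ) : ℂ) * Complex.I := by push_cast; ring
  rw [this, Complex.exp_mul_I, ← Complex.ofReal_cos, ← Complex.ofReal_sin, Real.cos_pi_div_four,
    Real.sin_pi_div_four, Real.sqrt_div_self, Complex.ofReal_inv]
  ring

theorem vecMulVec_qubitState_of_ne_I {q : Pauli} (hq : q ≠ .I) (σ : ℤˣ) :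
    vecMulVec (qubitState q σ) (star (qubitState q σ)) =
      (2⁻¹ : ℂ) • (Pauli.I.mat + sgn σ • q.mat) := by
  have h := inv_sqrt_two_mul_self
  cases q
  · exact absurd rfl hq
  all_goals
    rcases Int.units_eq_one_or σ with rfl | rfl <;> ext a b <;> fin_cases a <;> fin_cases b <;>
      simp [qubitState, sgn, Pauli.mat, vecMulVec, div_eq_mul_inv, h] <;> grind [Complex.I_mul_I]

theorem vecMulVec_qubitState_I (σ : ℤˣ) :
    vecMulVec (qubitState .I σ) (star (qubitState .I σ)) =
      (2⁻¹ : ℂ) • (Pauli.I.mat + (√2 : ℂ)⁻¹ • (Pauli.X.mat + Pauli.Y.mat)) := by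
  have h := inv_sqrt_two_mul_self
  simp only [qubitState, exp_I_mul_pi_div_four]
  ext a b
  fin_cases a <;> fin_cases b <;> simp [Pauli.mat, vecMulVec, div_eq_mul_inv, h] <;>
    grind [Complex.I_mul_I]

theorem overlap_of_ne_I {q : Pauli} (hq : q ≠ .I) (q' : Pauli) :
    overlap q q' = if q = q' then 1 else 0 := by
  simp only [overlap, expect_units_int, expectation_eq_trace, vecMulVec_qubitState_of_ne_I hq,
    qubitEigenvalue, if_neg hq, Matrix.mul_smul, mul_add, trace_smul, trace_add,
    Pauli.trace_mat_mul, eq_comm (a := q')]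
  split_ifs <;> simp [sgn] <;> grind

theorem overlap_I_left (q' : Pauli) :
    overlap .I q' = if q' = .I then 1 else if q' = .Z then 0 else (√2 : ℂ)⁻¹ := by
  simp only [overlap, expectation_eq_trace, vecMulVec_qubitState_I, Fintype.expect_const,
    qubitEigenvalue, if_true, Matrix.mul_smul, mul_add, trace_smul, trace_add, Pauli.trace_mat_mul]
  cases q' <;> simp [sgn, mul_comm]

theorem overlap_self (q : Pauli) : overlap q q = 1 := by
  rcases eq_or_ne q .I with rfl | hq
  · rw [overlap_I_left, if_pos rfl]
  · rw [overlap_of_ne_I hq, if_pos rfl]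

theorem norm_overlap_le {q q' : Pauli} (h : q ≠ q') : ‖overlap q q'‖ ≤ (√2)⁻¹ := by
  rcases eq_or_ne q .I with rfl | hq
  · rw [overlap_I_left, if_neg h.symm]
    split_ifs <;> simp [abs_of_nonneg]
  · rw [overlap_of_ne_I hq, if_neg h, norm_zero]
    positivity

theorem norm_overlap_le_one (q q' : Pauli) : ‖overlap q q'‖ ≤ 1 := by
  rcases eq_or_ne q q' with rfl | h
  · rw [overlap_self, norm_one]
  · exact (norm_overlap_le h).trans (inv_lt_one_of_one_lt₀ Real.one_lt_sqrt_two).le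

theorem norm_prod_overlap_le {Q Q' : Fin n → Pauli} (h : Q ≠ Q') :
    ‖∏ j, overlap (Q j) (Q' j)‖ ≤ (√2)⁻¹ := by
  obtain ⟨j, hj⟩ := Function.ne_iff.1 h
  rw [norm_prod, ← Finset.mul_prod_erase _ _ (Finset.mem_univ j)]
  exact (mul_le_of_le_one_right (norm_nonneg _) <|
    Finset.prod_le_one (fun _ _ ↦ norm_nonneg _) fun _ _ ↦ norm_overlap_le_one _ _).trans
      (norm_overlap_le hj)

theorem expect_sgn_mul_expectation_inputState (Q Q' : Fin n → Pauli) :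
    𝔼 σ : Fin n → ℤˣ, sgn (∏ j, qubitEigenvalue (Q j) (σ j)) *
      expectation (pauliOp Q') (inputState Q σ).1 = ∏ j, overlap (Q j) (Q' j) := by
  simp only [pauliOp, inputState_eq_tensorVec, expectation_tensor_tensorVec, sgn_prod,
    ← Finset.prod_mul_distrib, overlap]
  exact expect_prod_eq_prod_expect fun j s ↦
    sgn (qubitEigenvalue (Q j) s) * expectation (Q' j).mat (qubitState (Q j) s)

theorem expect_bornProb_neg_predicted {V : UnitaryOp n} {P : Fin n → Pauli}
    (r : ℤˣ × (Fin n → Pauli)) {r' : ℤˣ × (Fin n → Pauli)}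
    (hr' : (V : Op n)ᴴ * pauliOp P * (V : Op n) = sgn r'.1 • pauliOp r'.2) :
    𝔼 σ, bornProb P ((inputState r.2 σ).apply V) (-predicted r σ) =
      (1 - (sgn r.1 * sgn r'.1 * ∏ j, overlap (r.2 j) (r'.2 j)).re) / 2 := by
  have bornProb_eq (σ) : bornProb P ((inputState r.2 σ).apply V) (-predicted r σ) =
      (1 - (sgn r.1 * sgn r'.1 * (sgn (∏ j, qubitEigenvalue (r.2 j) (σ j)) *
        expectation (pauliOp r'.2) (inputState r.2 σ).1)).re) / 2 := by
    rw [bornProb_eq_expectation, PureState.apply, expectation_mulVec, hr', expectation_smul,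
      predicted_eq, sgn_neg, sgn_mul, neg_mul, Complex.neg_re, ← sub_eq_add_neg]
    congr 3
    ring
  simp only [bornProb_eq]
  rw [← Finset.expect_div, Finset.expect_sub_distrib, Fintype.expect_const, ← Complex.re_expect,
    ← Finset.mul_expect, expect_sgn_mul_expectation_inputState]

theorem re_sgn_mul_prod_overlap_le {r r' : ℤˣ × (Fin n → Pauli)} (h : r ≠ r') :
    (sgn r.1 * sgn r'.1 * ∏ j, overlap (r.2 j) (r'.2 j)).re ≤ (√2)⁻¹ := by
  by_cases hQ : r.2 = r'.2
  · have sign_eq_neg : r'.1 = -r.1 :=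
      Int.units_ne_iff_eq_neg.1 fun hs ↦ h (Prod.ext hs.symm hQ)
    simp only [hQ, overlap_self, Finset.prod_const_one, mul_one, sign_eq_neg, sgn_neg, mul_neg,
      sgn_mul_self, Complex.neg_re, Complex.one_re]
    exact (neg_nonpos.2 zero_le_one).trans (inv_nonneg.2 (Real.sqrt_nonneg 2))
  · refine (Complex.re_le_norm _).trans ?_
    rw [norm_mul, norm_mul, norm_sgn, norm_sgn, one_mul, one_mul]
    exact norm_prod_overlap_le hQ

/-! ### One run of the test -/

theorem toMeasure_real_bind_uniformOfFintype {α β : Type*} [Fintype α] [Nonempty α]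
    [MeasurableSpace β] (f : α → PMF β) {s : Set β} (hs : MeasurableSet s) :
    ((PMF.uniformOfFintype α).bind f).toMeasure.real s = 𝔼 a, (f a).toMeasure.real s := by
  rw [Measure.real, PMF.toMeasure_bind_apply _ _ _ hs, tsum_fintype, ENNReal.toReal_sum fun _ _ ↦
    ENNReal.mul_ne_top (PMF.apply_ne_top _ _) (measure_ne_top _ _), Fintype.expect_eq_sum_div_card,
    Finset.sum_div]
  simp [Measure.real, div_eq_inv_mul]

theorem measurePauli_toMeasure_real_singleton (P : Fin n → Pauli) (φ : PureState n) (m : ℤˣ) :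
    (measurePauli P φ).toMeasure.real {m} = bornProb P φ m := by
  rw [Measure.real, PMF.toMeasure_apply_singleton _ _ (measurableSet_singleton m), measurePauli,
    PMF.ofFintype_apply, ENNReal.toReal_ofReal (bornProb_nonneg P φ m)]

theorem test_real_eq_mul (U V : UnitaryOp n) (ε : ℤˣ) :
    (test U V).toMeasure.real {r | r.2 = ε * r.1} =
      𝔼 P, 𝔼 σ, bornProb P ((inputState (pullback (U : Op n) P).2 σ).apply V)
        (ε * predicted (pullback (U : Op n) P) σ) := by
  have measure_real_eq (P : Fin n → Pauli) (φ : PureState n) (t : ℤˣ) :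
      ((measurePauli P φ).map fun m ↦ (t, m)).toMeasure.real {r | r.2 = ε * r.1} =
        bornProb P φ (ε * t) := by
    rw [Measure.real, PMF.toMeasure_map_apply _ _ _ (by fun_prop) .of_discrete,
      ← measurePauli_toMeasure_real_singleton]
    rfl
  simp only [test, toMeasure_real_bind_uniformOfFintype _ MeasurableSet.of_discrete,
    measure_real_eq]

theorem test_real_eq_predicted_of_sameChannel {U V : UnitaryOp n} (hU : IsClifford (U : Op n))
    (h : SameChannel (U : Op n) (V : Op n)) :
    (test U V).toMeasure.real {r | r.2 = r.1} = 1 := by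
  have real_eq := test_real_eq_mul U V 1
  simpa only [one_mul, bornProb_predicted_of_sameChannel hU h, Fintype.expect_const] using real_eq

theorem le_test_real_eq_neg_predicted {U V : UnitaryOp n} (hU : IsClifford (U : Op n))
    (hV : IsClifford (V : Op n)) (h : ¬ SameChannel (U : Op n) (V : Op n)) :
    (1 - (√2)⁻¹) / 4 ≤ (test U V).toMeasure.real {r | r.2 = -r.1} := by
  have real_eq := test_real_eq_mul U V (-1)
  simp only [neg_one_mul] at real_eq
  have half_le := half_le_expect_of_pauliOp_notMem (a := (1 - (√2)⁻¹) / 2)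
    (mt sameChannel_of_agreeingObservables_eq_top h)
    (f := fun P ↦ 𝔼 σ, bornProb P ((inputState (pullback (U : Op n) P).2 σ).apply V)
      (-predicted (pullback (U : Op n) P) σ))
    (fun P ↦ Finset.expect_nonneg fun σ _ ↦ bornProb_nonneg _ _ _) fun P hP ↦ by
      have pullback_ne : pullback (U : Op n) P ≠ pullback (V : Op n) P := fun hUV ↦
        hP (mem_agreeingObservables.2 (by rw [hU.pullback_spec, hV.pullback_spec, hUV]))
      rw [expect_bornProb_neg_predicted _ (hV.pullback_spec P)]
      linarith [re_sgn_mul_prod_overlap_le pullback_ne]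
  rw [real_eq]
  linarith

theorem test_real_eq_predicted (U V : UnitaryOp n) :
    (test U V).toMeasure.real {r | r.2 = r.1} =
      1 - (test U V).toMeasure.real {r | r.2 = -r.1} := by
  have eq_compl : {r : ℤˣ × ℤˣ | r.2 = r.1} = {r | r.2 = -r.1}ᶜ := by
    ext r
    simp only [Set.mem_ofPred_eq, Set.mem_compl_iff, ← Int.units_ne_iff_eq_neg, not_not]
  rw [eq_compl, probReal_compl_eq_one_sub MeasurableSet.of_discrete]

/-! ### Independent runs -/

theorem measureReal_pi_exists_notMem {ι Ω : Type*} [Fintype ι] [MeasurableSpace Ω] (μ : Measure Ω)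
    [IsProbabilityMeasure μ] {A : Set Ω} (hA : MeasurableSet A) :
    (Measure.pi fun _ : ι ↦ μ).real {ω | ∃ i, ω i ∉ A} = 1 - μ.real A ^ Fintype.card ι := by
  have eq_compl : {ω : ι → Ω | ∃ i, ω i ∉ A} = (Set.univ.pi fun _ ↦ A)ᶜ := by
    ext ω
    simp [Set.mem_pi]
  rw [eq_compl, probReal_compl_eq_one_sub (.univ_pi fun _ ↦ hA), Measure.real, Measure.pi_pi]
  simp [Measure.real]

theorem repeatedTest_real_detected (U V : UnitaryOp n) (k : ℕ) :
    (repeatedTest U V k).real (detected k) =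
      1 - (test U V).toMeasure.real {r | r.2 = r.1} ^ k := by
  simpa [repeatedTest, detected] using
    measureReal_pi_exists_notMem (ι := Fin k) (test U V).toMeasure (A := {r | r.2 = r.1})
      .of_discrete

theorem pow_le_of_inv_mul_log_le {p c δ : ℝ} (hp : 0 ≤ p) (hc : 0 < c) (hpc : p ≤ 1 - c)
    (hδ : 0 < δ) {k : ℕ} (hk : c⁻¹ * Real.log (1 / δ) ≤ k) : p ^ k ≤ δ :=
  calc p ^ k ≤ Real.exp (-c) ^ k :=
        pow_le_pow_left₀ hp (hpc.trans (Real.one_sub_le_exp_neg c)) k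
    _ = Real.exp (-(c * k)) := by rw [← Real.exp_nat_mul, mul_neg, mul_comm]
    _ ≤ Real.exp (Real.log δ) := by
        rw [one_div, Real.log_inv, inv_mul_le_iff₀ hc] at hk
        exact Real.exp_le_exp.2 (neg_le.1 hk)
    _ = δ := Real.exp_log hδ

theorem one_sub_le_repeatedTest_real_detected {U V : UnitaryOp n} {c δ : ℝ} (hc : 0 < c)
    (h : c ≤ (test U V).toMeasure.real {r | r.2 = -r.1}) (hδ : 0 < δ) {k : ℕ}
    (hk : c⁻¹ * Real.log (1 / δ) ≤ k) : 1 - δ ≤ (repeatedTest U V k).real (detected k) := by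
  rw [repeatedTest_real_detected, test_real_eq_predicted]
  refine sub_le_sub_left (pow_le_of_inv_mul_log_le ?_ hc (sub_le_sub_left h 1) hδ hk) 1
  exact sub_nonneg.2 measureReal_le_one

end CliffordTest

theorem mainTheorem2 :
    -- every circuit of Pauli, Hadamard, phase and CNOT gates is a Clifford unitary
    (∀ (n : ℕ) (gates : List (Gate n)), IsClifford (circuitMat gates)) ∧
    -- the constants do not depend on the number of qubits or on the unitaries
    ∃ c C : ℝ, 0 < c ∧ 0 < C ∧
      ∀ (n : ℕ) (U V : UnitaryOp n), IsClifford (U : Op n) → IsClifford (V : Op n) →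
        -- `U† P U` is the signed Pauli that the test works with
        (∀ P : Fin n → Pauli,
          (U : Op n)ᴴ * pauliOp P * (U : Op n) =
            sgn (pullback (U : Op n) P).1 • pauliOp (pullback (U : Op n) P).2) ∧
        -- the input state is an eigenstate of it, with the predicted eigenvalue
        (∀ (P : Fin n → Pauli) (σ : Fin n → ℤˣ),
          ((U : Op n)ᴴ * pauliOp P * (U : Op n)) *ᵥ (inputState (pullback (U : Op n) P).2 σ).1 =
            sgn (predicted (pullback (U : Op n) P) σ) •
              (inputState (pullback (U : Op n) P).2 σ).1) ∧
        -- equal channels: the outcome is the predicted one, and no difference is ever reported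
        (SameChannel (U : Op n) (V : Op n) →
          (test U V).toMeasure.real {r | r.2 = r.1} = 1 ∧
          ∀ k : ℕ, (repeatedTest U V k).real (detected k) = 0) ∧
        -- different channels: constant probability of the opposite outcome in one run,
        -- and detection with probability at least `1 - δ` after `O(log (1/δ))` runs
        (¬ SameChannel (U : Op n) (V : Op n) →
          c ≤ (test U V).toMeasure.real {r | r.2 = -r.1} ∧
          ∀ δ : ℝ, 0 < δ → δ < 1 → ∀ k : ℕ, C * Real.log (1 / δ) ≤ k →
            1 - δ ≤ (repeatedTest U V k).real (detected k)) := by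
  have c_pos : 0 < (1 - (√2)⁻¹) / 4 :=
    div_pos (sub_pos.2 (inv_lt_one_of_one_lt₀ Real.one_lt_sqrt_two)) four_pos
  refine ⟨fun _ ↦ isClifford_circuitMat, _, _, c_pos, inv_pos.2 c_pos, fun n U V hU hV ↦
    ⟨hU.pullback_spec, hU.conj_mulVec_inputState, fun same ↦ ?_, fun different ↦ ?_⟩⟩
  · have predicted_surely := test_real_eq_predicted_of_sameChannel hU same
    refine ⟨predicted_surely, fun k ↦ ?_⟩
    rw [repeatedTest_real_detected, predicted_surely, one_pow, sub_self]
  · have le_opposite := le_test_real_eq_neg_predicted hU hV different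
    exact ⟨le_opposite, fun δ hδ _ k hk ↦
      one_sub_le_repeatedTest_real_detected c_pos le_opposite hδ hk⟩
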